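/- Let $\mathbb F_q$ be a finite field with $q$ elements, let $n,r,\ell$ be integers with $r\mid n$ and $0\le \ell<n/2-n/r$, and index coordinates by $[n]=\{0,\dots,n-1\}$. **Random qLRC.** Let $H_X,H_Z$ be the $(n/r)\times n$ matrices over $\mathbb F_q$ with, for $0\le i<n/r$ and $0\le j<n$, $$(H_X)_{i,j}=\begin{cases}1,& ri\le j\le ri+r-1\\0,&\text{otherwise,}\end{cases}\qquad (H_Z)_{i,j}=\begin{cases}-(r-1),& j=ri\\ 1,& ri+1\le j\le ri+r-1\\0,&\text{otherwise.}\end{cases}$$ Repeat $\ell$ times: sample a uniformly random vector of $\text{row-span}(H_Z)^\perp\setminus\text{row-span}(H_X)$ and add it as a new row to $H_X$. Then repeat $\ell$ times: sample a uniformly random vector of $\text{row-span}(H_X)^\perp\setminus\text{row-span}(H_Z)$ and add it as a new row to $H_Z$. The random qLRC is $\mathcal C=\operatorname{CSS}(C_X,C_Z)$ with $C_X=\ker H_X$, $C_Z=\ker H_Z$, where $$\operatorname{CSS}(C_X,C_Z)=\operatorname{span}\Big\{\sum_{y\in C_X^\perp}|x+y\rangle : x\in C_Z\Big\}\subseteq(\mathbb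 C^{\mathbb F_q})^{\otimes n}.$$ **Distance.** The distance $d(\mathcal C)$ is the largest $d\in\mathbb N$ such that for every set $S\subseteq[n]$ of fewer than $d$ qudits there is a quantum channel $\operatorname{Dec}^S$ from the qudits $[n]\setminus S$ to all $n$ qudits with $\operatorname{Dec}^S(\operatorname{Tr}_S|\psi\rangle\langle\psi|)=|\psi\rangle\langle\psi|$ for all unit vectors $|\psi\rangle\in\mathcal C$. **Entropy.** Let $H_q(x)=x\log_q(q-1)-x\log_q x-(1-x)\log_q(1-x)$ for $0\le x\le 1$, with $0\log_q 0=0$. **Proposition.** Let $\delta,\epsilon>0$. 1. If $\delta\le 1-1/q$ and $\ell\ge(H_q(\delta)+\epsilon)n$, then $$\Pr[d(\mathcal C)\ge\delta n]>1-2q^{-\epsilon n}.$$ 2. If $q\ge 2^{2/\epsilon}$ and $\ell\ge(\delta+\epsilon)n$, then $$\Pr[d(\mathcal C)\ge\delta n]>1-2q^{-\epsilon n/2}.$$ -/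

import Mathlib

open scoped ENNReal

namespace RandomQLRC

noncomputable section

/-! ### Quantum codes and their distance

A pure state of qudits labelled by `ι`, each with computational basis `A`, is a vector of
`(ℂ^A)^{⊗ ι} = ((ι → A) → ℂ)`, given by its coordinates in the product basis.
An operator on these qudits is a matrix indexed by `ι → A`. -/

/-- The computational basis vector `|x⟩`. -/
def ket {X : Type*} (x : X) : X → ℂ :=
  open Classical in fun z => if z = x then 1 else 0

/-- The density matrix `|ψ⟩⟨ψ|`. -/
def density {X : Type*} (ψ : X → ℂ) : Matrix X X ℂ :=
  Matrix.vecMulVec ψ (star ψ)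

/-- A quantum channel: `ρ ↦ ∑ ν, K ν * ρ * (K ν)†` for Kraus operators with
`∑ ν, (K ν)† * K ν = I`. -/
def IsQuantumChannel {X Y : Type*} [Fintype X] [Fintype Y]
    (Φ : Matrix X X ℂ → Matrix Y Y ℂ) : Prop :=
  open Classical in
  ∃ (N : ℕ) (K : Fin N → Matrix Y X ℂ),
    (∑ ν, (K ν).conjTranspose * K ν = 1) ∧
      ∀ ρ, Φ ρ = ∑ ν, K ν * ρ * (K ν).conjTranspose

/-- The word whose letters are `z` on `S` and `x` off `S`. -/
def glue {ι A : Type*} (S : Finset ι) (x : {i // i ∉ S} → A) (z : {i // i ∈ S} → A) : ι → A :=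
  open Classical in fun i => if h : i ∈ S then z ⟨i, h⟩ else x ⟨i, h⟩

/-- The reduced density matrix on the qudits outside `S` (partial trace over `S`). -/
def traceOut {ι A : Type*} [Fintype A] (S : Finset ι)
    (ρ : Matrix (ι → A) (ι → A) ℂ) :
    Matrix ({i // i ∉ S} → A) ({i // i ∉ S} → A) ℂ :=
  open Classical in
  Matrix.of fun x y => ∑ z : {i // i ∈ S} → A, ρ (glue S x z) (glue S y z)

/-- The code `C` can decode from erasures in `S`: some channel from the qudits outside `S` to all
qudits restores every code state. -/
def CanDecodeErasures {n : ℕ} {A : Type*} [Fintype A]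
    (C : Submodule ℂ ((Fin n → A) → ℂ)) (S : Finset (Fin n)) : Prop :=
  open Classical in
  ∃ Dec : Matrix ({i // i ∉ S} → A) ({i // i ∉ S} → A) ℂ →
      Matrix (Fin n → A) (Fin n → A) ℂ,
    IsQuantumChannel Dec ∧
      ∀ ψ ∈ C, ∑ x, ‖ψ x‖ ^ 2 = 1 → Dec (traceOut S (density ψ)) = density ψ

/-- The distance of a quantum code: the largest `d` such that the code can decode from erasures in
every set of fewer than `d` qudits. (It is `⊤` exactly if there is no largest such `d`, which
happens only for codes of vector space dimension at most one.) -/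
def distance {n : ℕ} {A : Type*} [Fintype A]
    (C : Submodule ℂ ((Fin n → A) → ℂ)) : ℕ∞ :=
  ⨆ d ∈ {d : ℕ | ∀ S : Finset (Fin n), S.card < d → CanDecodeErasures C S}, (d : ℕ∞)

/-! ### CSS codes -/

/-- The dual `C^⊥` of a linear code with respect to the dot product. -/
def dual {n : ℕ} {F : Type*} [Field F] (C : Submodule F (Fin n → F)) :
    Submodule F (Fin n → F) where
  carrier := {v | ∀ c ∈ C, v ⬝ᵥ c = 0}
  zero_mem' := fun c _ => zero_dotProduct c
  add_mem' := fun {v w} hv hw c hc => by rw [add_dotProduct, hv c hc, hw c hc, add_zero]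
  smul_mem' := fun a v hv c hc => by rw [smul_dotProduct, hv c hc, smul_zero]

/-- `CSS(C_X, C_Z)`, the span of the vectors `∑ y ∈ C_X^⊥, |x + y⟩` for `x ∈ C_Z`. -/
def css {n : ℕ} {F : Type*} [Field F] [Fintype F] (CX CZ : Submodule F (Fin n → F)) :
    Submodule ℂ ((Fin n → F) → ℂ) :=
  open Classical in
  Submodule.span ℂ
    {φ | ∃ x ∈ CZ, φ = ∑ y ∈ Finset.univ.filter (fun y => y ∈ dual CX), ket (x + y)}

/-- The span of the rows of a matrix. -/
def rowSpan {k n : ℕ} {F : Type*} [Field F] (H : Matrix (Fin k) (Fin n) F) :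
    Submodule F (Fin n → F) :=
  Submodule.span F (Set.range fun i => H i)

/-- The code with parity check matrix `H`. -/
def kerCode {k n : ℕ} {F : Type*} [Field F] (H : Matrix (Fin k) (Fin n) F) :
    Submodule F (Fin n → F) :=
  LinearMap.ker H.mulVecLin

/-! ### Random quantum locally recoverable codes -/

/-- The initial `X` parity checks: row `i` is the indicator of the block
`{r i, …, r i + r - 1}`. -/
def initX (F : Type*) [Field F] (n r : ℕ) : Matrix (Fin (n / r)) (Fin n) F :=
  Matrix.of fun i j =>
    if r * (i : ℕ) ≤ (j : ℕ) ∧ (j : ℕ) < r * (i : ℕ) + r then 1 else 0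

/-- The initial `Z` parity checks: row `i` is `-(r - 1)` at `r i`, is `1` at
`r i + 1, …, r i + r - 1`, and vanishes elsewhere. -/
def initZ (F : Type*) [Field F] (n r : ℕ) : Matrix (Fin (n / r)) (Fin n) F :=
  Matrix.of fun i j =>
    if (j : ℕ) = r * (i : ℕ) then -((r : F) - 1)
    else if r * (i : ℕ) < (j : ℕ) ∧ (j : ℕ) < r * (i : ℕ) + r then 1 else 0

/-- The uniform distribution on `W ∖ V`. (If `W ⊆ V` there is none and the value is irrelevant; in
the sampling procedure below this does not happen as long as `ℓ ≤ n / 2 - n / r` and `r ≥ 2`.) -/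
def uniformDiff {n : ℕ} {F : Type*} [Field F] [Fintype F] (W V : Submodule F (Fin n → F)) :
    PMF (Fin n → F) :=
  open Classical in
  if h : (Finset.univ.filter fun v => v ∈ W ∧ v ∉ V).Nonempty then PMF.uniformOfFinset _ h
  else PMF.pure 0

/-- Repeat `t` times, starting from `H`: append a uniformly random vector of
`W ∖ rowSpan (current matrix)` as a new last row. -/
def addRows {m n : ℕ} {F : Type*} [Field F] [Fintype F] (W : Submodule F (Fin n → F))
    (H : Matrix (Fin m) (Fin n) F) : (t : ℕ) → PMF (Matrix (Fin (m + t)) (Fin n) F)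
  | 0 => PMF.pure H
  | t + 1 =>
    (addRows W H t).bind fun H' =>
      (uniformDiff W (rowSpan H')).map fun v =>
        Matrix.of (Fin.snoc (α := fun _ => Fin n → F) (fun i => H' i) v)

/-- The random pair `(H_X, H_Z)`: first `ℓ` random rows are added to `H_X`, one after the other and
orthogonal to the rows of the initial `H_Z`, then `ℓ` random rows are added to `H_Z`, orthogonal to
the rows of the completed `H_X`. -/
def sampleChecks (F : Type*) [Field F] [Fintype F] (n r ℓ : ℕ) :
    PMF (Matrix (Fin (n / r + ℓ)) (Fin n) F × Matrix (Fin (n / r + ℓ)) (Fin n) F) :=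
  (addRows (dual (rowSpan (initZ F n r))) (initX F n r) ℓ).bind fun HX =>
    (addRows (dual (rowSpan HX)) (initZ F n r) ℓ).map fun HZ => (HX, HZ)

/-- The random qLRC `CSS(ker H_X, ker H_Z)`. -/
def randomQLRC (F : Type*) [Field F] [Fintype F] (n r ℓ : ℕ) :
    PMF (Submodule ℂ ((Fin n → F) → ℂ)) :=
  (sampleChecks F n r ℓ).map fun H => css (kerCode H.1) (kerCode H.2)

/-- The probability that the random qLRC has distance at least `x`. -/
def probDistanceGE (F : Type*) [Field F] [Fintype F] (n r ℓ : ℕ) (x : ℝ) : ℝ :=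
  ((randomQLRC F n r ℓ).toOuterMeasure
    {C | ENNReal.ofReal x ≤ ((distance C : ℕ∞) : ℝ≥0∞)}).toReal

/-- The `q`-ary entropy function (with `0 * log 0 = 0`). -/
def qEntropy (q x : ℝ) : ℝ :=
  x * Real.logb q (q - 1) - x * Real.logb q x - (1 - x) * Real.logb q (1 - x)

end

end RandomQLRC

namespace RandomQLRC

open Classical

/-! ### Erasure correction of CSS codes -/

/-! A CSS code corrects the erasure of `S` once `S` supports no nontrivial logical operator: every
word of `C_Z` supported on `S` lies in `C_X^⊥`, and every word of `C_X` supported on `S` lies in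
`C_Z^⊥` (`css_canDecodeErasures`). Put `U = C_Z` and `V = C_X^⊥`. Code states live on `U` and are
constant on cosets of `V`. The second condition, dualized, gives each coset a representative
vanishing on `S`; the first makes the coset readable outside `S`. The decoder reads the coset
coherently and prepares it afresh, and what it discards carries no information about the state.

Hence the distance is at least `δ n` unless some nonzero word of weight below `δ n` is a nontrivial
logical operator. A fixed word passes `ℓ` random checks with probability at most `q ^ (-ℓ)`: if it
is orthogonal to the current rows but not to the whole sampling space, translating by a multiple of
a detecting vector never lands in the excluded row span, so a new row misses it with probability at
most `1 / q` (`uniformDiff_orthogonal_le`, `addRows_orthogonal_le`). A union bound over light words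
and over the two error types gives failure probability at most `2 * N * q ^ (-ℓ)`, with `N` the
number of light words (`probDistanceGE_ge`).

The Hamming ball estimate `N < q ^ (H_q(δ) n)` (`card_lightWords_lt`) proves the first claim. The
second reduces to it through `H_q(δ) ≤ δ + log 2 / log q` (`qEntropy_le`), where large `q` makes the
last term at most `ε / 2`. -/

theorem dual_eq_orthogonal {n : ℕ} {F : Type*} [Field F] (C : Submodule F (Fin n → F)) :
    dual C = LinearMap.BilinForm.orthogonal (dotProductBilin F F) C := by
  ext v
  simp only [LinearMap.BilinForm.mem_orthogonal_iff]
  refine forall₂_congr fun c _ => ?_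
  rw [dotProduct_comm]
  rfl

theorem mem_dual {n : ℕ} {F : Type*} [Field F] {C : Submodule F (Fin n → F)} {v : Fin n → F} :
    v ∈ dual C ↔ ∀ c ∈ C, v ⬝ᵥ c = 0 := Iff.rfl

theorem dual_dual {n : ℕ} {F : Type*} [Field F] (C : Submodule F (Fin n → F)) :
    dual (dual C) = C := by
  rw [dual_eq_orthogonal, dual_eq_orthogonal]
  refine LinearMap.BilinForm.orthogonal_orthogonal ⟨fun x hx => ?_, fun x hx => ?_⟩ ?_ C
  · exact dotProduct_eq_zero x hx
  · exact dotProduct_eq_zero x fun w => by rw [dotProduct_comm]; exact hx w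
  · intro x y h
    exact (dotProduct_comm y x).trans h

/-- Restriction of a word to the coordinates outside `S`. -/
def resOff {n : ℕ} (F : Type*) [Field F] (S : Finset (Fin n)) :
    (Fin n → F) →ₗ[F] ({i // i ∉ S} → F) :=
  LinearMap.funLeft F F Subtype.val

section
variable {n : ℕ} {F : Type*} [Field F] {S : Finset (Fin n)}

@[simp] theorem resOff_apply (x : Fin n → F) (i : {i // i ∉ S}) : resOff F S x i = x i := rfl

@[simp] theorem resOff_glue (x : {i // i ∉ S} → F) (z : {i // i ∈ S} → F) :
    resOff F S (glue S x z) = x := by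
  ext ⟨i, hi⟩
  simp [glue, hi]

theorem eq_zero_of_resOff_eq_zero {a : Fin n → F} (h : resOff F S a = 0)
    (hS : ∀ i ∈ S, a i = 0) : a = 0 := by
  ext i
  by_cases hi : i ∈ S
  · exact hS i hi
  · exact congrFun h ⟨i, hi⟩

theorem glue_resOff_add {a : Fin n → F} (hS : ∀ i ∈ S, a i = 0) (m : {i // i ∉ S} → F)
    (z : {i // i ∈ S} → F) : glue S (resOff F S a + m) z = a + glue S m z := by
  ext i
  by_cases hi : i ∈ S <;> simp [glue, hi, hS]

/-- If every word of `U` agrees on `S` with a word of `V`, and words of `U` supported on `S` lie in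
`V`, then cosets of `V` in `U` can be read off from the coordinates outside `S`. -/
theorem exists_coset_reader {U V : Submodule F (Fin n → F)} (hVU : V ≤ U)
    (hsupp : ∀ u ∈ U, resOff F S u = 0 → u ∈ V)
    (hagree : ∀ u ∈ U, ∃ v ∈ V, ∀ i ∈ S, u i = v i) :
    ∃ (L : Submodule F (Fin n → F)) (M : Submodule F ({i // i ∉ S} → F))
      (π : ({i // i ∉ S} → F) → (Fin n → F)),
      L ≤ U ∧ (∀ a ∈ L, ∀ i ∈ S, a i = 0) ∧ Disjoint L V ∧ L ⊔ V = U ∧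
      V.map (resOff F S) ≤ M ∧ Disjoint (L.map (resOff F S)) M ∧
      ∀ x, π x ∈ L ∧ x - resOff F S (π x) ∈ M := by
  let Z : Submodule F (Fin n → F) :=
    { carrier := {a | ∀ i ∈ S, a i = 0}
      zero_mem' := fun i _ => rfl
      add_mem' := fun ha hb i hi => by simp [ha i hi, hb i hi]
      smul_mem' := fun c a ha i hi => by simp [ha i hi] }
  -- Intersecting `L'` with `U ⊓ Z` gives a complement of `V ⊓ (U ⊓ Z)` inside `U ⊓ Z`. By `hagree`,
  -- `U = V + (U ⊓ Z)`, so this is also a complement of `V` in `U`.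
  obtain ⟨L', hL'⟩ := exists_isCompl (V ⊓ (U ⊓ Z))
  have hL1 : L' ⊓ (U ⊓ Z) ≤ U := inf_le_right.trans inf_le_left
  have hL2 : ∀ a ∈ L' ⊓ (U ⊓ Z), ∀ i ∈ S, a i = 0 := fun a ha => ha.2.2
  have hL3 : Disjoint (L' ⊓ (U ⊓ Z)) V := by
    rw [disjoint_iff, ← le_bot_iff, ← hL'.inf_eq_bot]
    exact fun a ha => ⟨⟨ha.2, ha.1.2⟩, ha.1.1⟩
  have hL4 : L' ⊓ (U ⊓ Z) ⊔ V = U := by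
    refine le_antisymm (sup_le hL1 hVU) fun u hu => ?_
    obtain ⟨v, hv, huv⟩ := hagree u hu
    have hd : u - v ∈ U ⊓ Z :=
      ⟨U.sub_mem hu (hVU hv), fun i hi => by simp [huv i hi]⟩
    have ht : u - v ∈ V ⊓ (U ⊓ Z) ⊔ L' := by rw [hL'.sup_eq_top]; trivial
    obtain ⟨b, hb, c, hc, hbc⟩ := Submodule.mem_sup.1 ht
    refine Submodule.mem_sup.2 ⟨c, ⟨hc, ?_⟩, b + v, V.add_mem hb.1 hv, ?_⟩
    · rw [show c = (u - v) - b by rw [← hbc]; abel]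
      exact Submodule.sub_mem _ hd hb.2
    · rw [show u = (u - v) + v by abel, ← hbc]; abel
  have hd : Disjoint (V.map (resOff F S)) ((L' ⊓ (U ⊓ Z)).map (resOff F S)) := by
    rw [Submodule.disjoint_def]
    rintro _ ⟨v, hv, rfl⟩ ⟨a, ha, hav⟩
    have h0 : a - v ∈ V := hsupp _ (U.sub_mem (hL1 ha) (hVU hv)) (by rw [map_sub, hav, sub_self])
    have haV : a ∈ V := by simpa using V.add_mem h0 hv
    rw [← hav, Submodule.disjoint_def.1 hL3 a ha haV, map_zero]
  -- Every word off `S` now splits uniquely into a part from `L`, naming the coset, and a part in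
  -- `M`; `π` extracts the former.
  obtain ⟨M, hVM, hM⟩ := hd.exists_isCompl
  have hπ : ∀ x, ∃ a ∈ L' ⊓ (U ⊓ Z), x - resOff F S a ∈ M := fun x => by
    have hx : x ∈ M ⊔ (L' ⊓ (U ⊓ Z)).map (resOff F S) := by rw [hM.sup_eq_top]; trivial
    obtain ⟨m, hm, _, ⟨a, ha, rfl⟩, rfl⟩ := Submodule.mem_sup.1 hx
    exact ⟨a, ha, by simpa using hm⟩
  choose π hπL hπM using hπ
  exact ⟨_, M, π, hL1, hL2, hL3, hL4, hVM, hM.disjoint.symm, fun x => ⟨hπL x, hπM x⟩⟩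

end

/-- Summing over words is the same as summing over their parts off and on `S`. -/
theorem sum_glue {n : ℕ} {F A : Type*} [Fintype F] [AddCommMonoid A] {S : Finset (Fin n)}
    (f : (Fin n → F) → A) :
    ∑ m : {i // i ∉ S} → F, ∑ z : {i // i ∈ S} → F, f (glue S m z) = ∑ w, f w := by
  rw [← Fintype.sum_prod_type']
  refine Fintype.sum_bijective (fun p : ({i // i ∉ S} → F) × ({i // i ∈ S} → F) => glue S p.1 p.2)
    ⟨?_, ?_⟩ _ _ fun _ => rfl
  · rintro ⟨m, z⟩ ⟨m', z'⟩ h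
    ext ⟨i, hi⟩
    · simpa [glue, hi] using congrFun h i
    · simpa [glue, hi] using congrFun h i
  · intro w
    refine ⟨(fun i => w i, fun i => w i), ?_⟩
    ext i
    by_cases hi : i ∈ S <;> simp [glue, hi]

theorem traceOut_density {n : ℕ} {F : Type*} [Fintype F] {S : Finset (Fin n)}
    (ψ : (Fin n → F) → ℂ) :
    traceOut S (density ψ) = ∑ z : {i // i ∈ S} → F,
      Matrix.vecMulVec (fun x => ψ (glue S x z)) (star fun x => ψ (glue S x z)) := by
  ext x y
  simp only [traceOut, density, Matrix.of_apply, Matrix.sum_apply, Matrix.vecMulVec_apply,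
    Pi.star_apply]
  exact Finset.sum_congr (by ext; simp) fun _ _ => rfl

/-! ### The decoding channel -/

section
variable {n : ℕ} {F : Type*} [Field F] [Fintype F] {S : Finset (Fin n)}

/-- The Kraus operators of the erasure decoder. -/
noncomputable def kraus (V : Submodule F (Fin n → F)) (π : ({i // i ∉ S} → F) → (Fin n → F))
    (m : {i // i ∉ S} → F) : Matrix (Fin n → F) ({i // i ∉ S} → F) ℂ :=
  Matrix.of fun y x =>
    if x - resOff F S (π x) = m ∧ y - π x ∈ V then (((√(Fintype.card V : ℝ))⁻¹ : ℝ) : ℂ) else 0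

theorem card_coset (V : Submodule F (Fin n → F)) (a : Fin n → F) :
    (Finset.univ.filter fun y => y - a ∈ V).card = Fintype.card V := by
  rw [Fintype.card_subtype]
  exact Finset.card_bij (fun y _ => y - a) (by simp) (by simp) fun b hb => ⟨b + a, by simpa using hb⟩

theorem norm_factor_mul_self (V : Submodule F (Fin n → F)) :
    (((√(Fintype.card V : ℝ))⁻¹ : ℝ) : ℂ) * (((√(Fintype.card V : ℝ))⁻¹ : ℝ) : ℂ) *
      (Fintype.card V : ℂ) = 1 := by
  have h : (Fintype.card V : ℝ) ≠ 0 := by exact_mod_cast Fintype.card_ne_zero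
  have : (√(Fintype.card V : ℝ))⁻¹ * (√(Fintype.card V : ℝ))⁻¹ * (Fintype.card V : ℝ) = 1 := by
    rw [← mul_inv, Real.mul_self_sqrt (Nat.cast_nonneg _), inv_mul_cancel₀ h]
  exact_mod_cast this

/-- The operator for `m` sends `|x⟩` to the normalized uniform superposition of the coset `π x + V`
if the `M`-part of `x` is `m`, and to zero otherwise. Distinct `x` with the same `M`-part have
distinct `π x` in `L`, hence disjoint cosets and orthogonal images. -/
theorem sum_kraus_conjTranspose_mul {L V : Submodule F (Fin n → F)}
    {π : ({i // i ∉ S} → F) → (Fin n → F)} (hLV : Disjoint L V) (hπ : ∀ x, π x ∈ L) :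
    ∑ m, (kraus V π m).conjTranspose * kraus V π m = 1 := by
  ext x x'
  simp only [Matrix.sum_apply, Matrix.mul_apply, Matrix.conjTranspose_apply, kraus, Matrix.of_apply,
    Matrix.one_apply]
  by_cases hx : x = x'
  · subst hx
    simp only [if_true]
    rw [Finset.sum_eq_single (x - resOff F S (π x)) (fun m _ hm => by simp [hm.symm]) (by simp)]
    simp only [true_and, apply_ite star, star_zero, ite_mul, mul_ite, zero_mul, mul_zero]
    simp only [← Finset.sum_filter, Finset.filter_filter, and_self, Finset.sum_const, card_coset]
    rw [nsmul_eq_mul, mul_comm]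
    simpa using norm_factor_mul_self V
  · rw [if_neg hx]
    refine Finset.sum_eq_zero fun m _ => Finset.sum_eq_zero fun y _ => ?_
    by_cases h1 : x - resOff F S (π x) = m ∧ y - π x ∈ V
    · by_cases h2 : x' - resOff F S (π x') = m ∧ y - π x' ∈ V
      · exfalso
        have hV : π x - π x' ∈ V := by simpa using V.sub_mem h2.2 h1.2
        have h0 := sub_eq_zero.1
          (Submodule.disjoint_def.1 hLV _ (L.sub_mem (hπ x) (hπ x')) hV)
        have h3 := h1.1.trans h2.1.symm
        rw [h0] at h3
        exact hx (sub_left_injective h3)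
      · simp [h2]
    · simp [h1]

/-- Each slice of a code state is returned as a multiple of the full state, with a factor depending
only on the discarded data `m` and `z`. This independence from `ψ` is what makes decoding exact. The
factor is nonzero exactly for the `|V|` pairs that glue to a word of `V`. -/
theorem kraus_mulVec {L U V : Submodule F (Fin n → F)} {M : Submodule F ({i // i ∉ S} → F)}
    {π : ({i // i ∉ S} → F) → (Fin n → F)} (hLU : L ≤ U) (hLS : ∀ a ∈ L, ∀ i ∈ S, a i = 0)
    (hLV : Disjoint L V) (hLVU : L ⊔ V = U) (hVM : V.map (resOff F S) ≤ M)
    (hLM : Disjoint (L.map (resOff F S)) M)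
    (hπ : ∀ x, π x ∈ L ∧ x - resOff F S (π x) ∈ M) {ψ : (Fin n → F) → ℂ}
    (hψU : ∀ y ∉ U, ψ y = 0) (hψV : ∀ y, ∀ v ∈ V, ψ (y + v) = ψ y)
    (m : {i // i ∉ S} → F) (z : {i // i ∈ S} → F) :
    (kraus V π m).mulVec (fun x => ψ (glue S x z)) =
      (if glue S m z ∈ V then (((√(Fintype.card V : ℝ))⁻¹ : ℝ) : ℂ) else 0) • ψ := by
  have hVU : V ≤ U := hLVU ▸ le_sup_right
  have hL0 : ∀ a ∈ L, resOff F S a ∈ M → a = 0 := fun a ha haM =>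
    eq_zero_of_resOff_eq_zero (Submodule.disjoint_def.1 hLM _ ⟨a, ha, rfl⟩ haM) (hLS a ha)
  ext y
  simp only [Matrix.mulVec, dotProduct, kraus, Matrix.of_apply, Pi.smul_apply, smul_eq_mul]
  by_cases hm : glue S m z ∈ V
  · rw [if_pos hm]
    have hmM : m ∈ M := hVM ⟨_, hm, resOff_glue m z⟩
    by_cases hy : y ∈ U
    · rw [← hLVU] at hy
      obtain ⟨b, hb, v, hv, rfl⟩ := Submodule.mem_sup.1 hy
      have hπb : π (resOff F S b + m) = b := by
        refine sub_eq_zero.1 (hL0 _ (L.sub_mem (hπ _).1 hb) ?_)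
        have := M.sub_mem hmM (hπ (resOff F S b + m)).2
        rw [map_sub]
        convert this using 1
        abel
      rw [Finset.sum_eq_single (resOff F S b + m)]
      · rw [hπb, if_pos (by simpa using hv), glue_resOff_add (hLS b hb), hψV _ _ hm, hψV _ _ hv]
      · intro x _ hx
        rw [if_neg, zero_mul]
        rintro ⟨h1, h2⟩
        have h3 : b - π x ∈ V := by
          have := V.sub_mem h2 hv
          convert this using 1
          abel
        have h4 := sub_eq_zero.1 (Submodule.disjoint_def.1 hLV _ (L.sub_mem hb (hπ x).1) h3)
        exact hx (by rw [h4, ← h1]; abel)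
      · simp
    · rw [hψU y hy, mul_zero]
      refine Finset.sum_eq_zero fun x _ => ?_
      rw [if_neg, zero_mul]
      rintro ⟨-, h2⟩
      exact hy (by simpa using U.add_mem (hVU h2) (hLU (hπ x).1))
  · rw [if_neg hm, zero_mul]
    refine Finset.sum_eq_zero fun x _ => ?_
    by_cases h : x - resOff F S (π x) = m ∧ y - π x ∈ V
    · rw [if_pos h, hψU, mul_zero]
      obtain ⟨rfl, -⟩ := h
      have hx : glue S x z = π x + glue S (x - resOff F S (π x)) z := by
        rw [← glue_resOff_add (hLS _ (hπ x).1)]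
        congr 1
        abel
      rw [hx]
      intro hU
      have hU' : glue S (x - resOff F S (π x)) z ∈ L ⊔ V := by
        rw [hLVU]
        simpa using U.sub_mem hU (hLU (hπ x).1)
      obtain ⟨b, hb, v, hv, hbv⟩ := Submodule.mem_sup.1 hU'
      have hb0 : b = 0 := by
        refine hL0 b hb ?_
        have := M.sub_mem (hπ x).2 (hVM ⟨v, hv, rfl⟩)
        convert this using 1
        rw [← resOff_glue (x - resOff F S (π x)) z, ← hbv, map_add]
        simp
      apply hm
      rw [← hbv, hb0, zero_add]
      exact hv
    · rw [if_neg h, zero_mul]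

/-- A code of states supported on `U` and invariant under shifts by `V` corrects the erasures of `S`
if cosets of `V` in `U` have representatives vanishing on `S` and are determined outside `S`. -/
theorem canDecodeErasures_of_invariant {C : Submodule ℂ ((Fin n → F) → ℂ)}
    {U V : Submodule F (Fin n → F)} (hVU : V ≤ U)
    (hC : ∀ ψ ∈ C, (∀ y ∉ U, ψ y = 0) ∧ ∀ y, ∀ v ∈ V, ψ (y + v) = ψ y)
    (hsupp : ∀ u ∈ U, resOff F S u = 0 → u ∈ V)
    (hagree : ∀ u ∈ U, ∃ v ∈ V, ∀ i ∈ S, u i = v i) : CanDecodeErasures C S := by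
  obtain ⟨L, M, π, hLU, hLS, hLV, hLVU, hVM, hLM, hπ⟩ := exists_coset_reader hVU hsupp hagree
  refine ⟨fun ρ => ∑ m, kraus V π m * ρ * (kraus V π m).conjTranspose,
    ⟨Fintype.card ({i // i ∉ S} → F), fun ν => kraus V π ((Fintype.equivFin _).symm ν), ?_, ?_⟩, ?_⟩
  · rw [Equiv.sum_comp (Fintype.equivFin _).symm
      fun m => (kraus V π m).conjTranspose * kraus V π m]
    convert sum_kraus_conjTranspose_mul hLV fun x => (hπ x).1
  · intro ρ
    rw [Equiv.sum_comp (Fintype.equivFin _).symm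
      fun m => kraus V π m * ρ * (kraus V π m).conjTranspose]
  · intro ψ hψ _
    have hterm : ∀ m (z : {i // i ∈ S} → F),
        kraus V π m * Matrix.vecMulVec (fun x => ψ (glue S x z)) (star fun x => ψ (glue S x z)) *
          (kraus V π m).conjTranspose =
        (if glue S m z ∈ V then (((√(Fintype.card V : ℝ))⁻¹ : ℝ) : ℂ) *
          (((√(Fintype.card V : ℝ))⁻¹ : ℝ) : ℂ) else 0) • density ψ := by
      intro m z
      rw [Matrix.mul_vecMulVec, Matrix.vecMulVec_mul, ← Matrix.star_mulVec,
        kraus_mulVec hLU hLS hLV hLVU hVM hLM hπ (hC ψ hψ).1 (hC ψ hψ).2]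
      ext a b
      by_cases h : glue S m z ∈ V
      · simp only [h, if_true, density, Matrix.vecMulVec_apply, Matrix.smul_apply, Pi.smul_apply,
          Pi.star_apply, smul_eq_mul, star_mul', Complex.star_def, Complex.conj_ofReal]
        ring
      · simp [h, Matrix.vecMulVec_apply]
    simp only [traceOut_density, Matrix.mul_sum, Matrix.sum_mul, hterm]
    rw [sum_glue (S := S) fun w => (if w ∈ V then (((√(Fintype.card V : ℝ))⁻¹ : ℝ) : ℂ) *
          (((√(Fintype.card V : ℝ))⁻¹ : ℝ) : ℂ) else 0) • density ψ, ← Finset.sum_smul,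
      ← Finset.sum_filter, Finset.sum_const, nsmul_eq_mul]
    have hcard : (Finset.univ.filter fun w => w ∈ V).card = Fintype.card V := by
      simpa using card_coset V 0
    rw [hcard, mul_comm, norm_factor_mul_self, one_smul]

theorem css_invariant {CX CZ : Submodule F (Fin n → F)} (h : dual CX ≤ CZ)
    {ψ : (Fin n → F) → ℂ} (hψ : ψ ∈ css CX CZ) :
    (∀ y ∉ CZ, ψ y = 0) ∧ ∀ y, ∀ v ∈ dual CX, ψ (y + v) = ψ y := by
  refine Submodule.span_induction ?_ ?_ ?_ ?_ hψ
  · rintro _ ⟨x, hx, rfl⟩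
    have key : ∀ w, (∑ y ∈ Finset.univ.filter (fun y => y ∈ dual CX), ket (x + y)) w =
        if w - x ∈ dual CX then 1 else 0 := by
      intro w
      simp only [Finset.sum_apply, ket]
      by_cases hw : w - x ∈ dual CX
      · rw [if_pos hw, Finset.sum_eq_single (w - x)]
        · simp
        · intro b _ hb
          rw [if_neg]
          rintro rfl
          simp at hb
        · simp [hw]
      · rw [if_neg hw]
        refine Finset.sum_eq_zero fun b hb => if_neg ?_
        rintro rfl
        simp at hb hw
        exact hw hb
    refine ⟨fun y hy => ?_, fun y v hv => ?_⟩
    · rw [key, if_neg fun hyx => hy (by simpa using CZ.add_mem (h hyx) hx)]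
    · rw [key, key]
      congr 1
      rw [show y + v - x = (y - x) + v by abel]
      exact propext (Submodule.add_mem_iff_left _ hv)
  · simp
  · rintro f g _ _ ⟨hf, hf'⟩ ⟨hg, hg'⟩
    exact ⟨fun y hy => by simp [hf y hy, hg y hy], fun y v hv => by simp [hf' y v hv, hg' y v hv]⟩
  · rintro c f _ ⟨hf, hf'⟩
    exact ⟨fun y hy => by simp [hf y hy], fun y v hv => by simp [hf' y v hv]⟩

/-- A CSS code corrects the erasures of `S` if `S` supports no nontrivial logical operator. -/
theorem css_canDecodeErasures {CX CZ : Submodule F (Fin n → F)} (h : dual CX ≤ CZ)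
    (hX : ∀ e ∈ CZ, resOff F S e = 0 → e ∈ dual CX)
    (hZ : ∀ e ∈ CX, resOff F S e = 0 → e ∈ dual CZ) :
    CanDecodeErasures (css CX CZ) S := by
  refine canDecodeErasures_of_invariant h (fun ψ hψ => css_invariant h hψ) hX fun u hu => ?_
  let Z : Submodule F (Fin n → F) :=
    { carrier := {a | ∀ i ∈ S, a i = 0}
      zero_mem' := fun i _ => rfl
      add_mem' := fun ha hb i hi => by simp [ha i hi, hb i hi]
      smul_mem' := fun c a ha i hi => by simp [ha i hi] }
  -- The orthogonal complement of `C_X^⊥ + Z` consists of the words of `C_X` supported on `S`, which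
  -- `hZ` places in `C_Z^⊥`; so `C_Z` lies in the double dual.
  have hu' : u ∈ dual (dual (dual CX ⊔ Z)) := by
    refine mem_dual.2 fun e he => ?_
    have he1 : e ∈ CX := by
      rw [← dual_dual CX]
      exact fun c hc => he c (Submodule.mem_sup_left hc)
    have he2 : resOff F S e = 0 := by
      ext ⟨i, hi⟩
      have : Pi.single i 1 ∈ Z := fun j hj => Pi.single_eq_of_ne (by rintro rfl; exact hi hj) _
      simpa using he _ (Submodule.mem_sup_right this)
    rw [dotProduct_comm]
    exact hZ e he1 he2 u hu
  rw [dual_dual] at hu'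
  obtain ⟨v, hv, a, ha, rfl⟩ := Submodule.mem_sup.1 hu'
  exact ⟨v, hv, fun i hi => by simp [ha i hi]⟩

end

/-! ### The sampling procedure -/

section
variable {n : ℕ} {F : Type*} [Field F]

theorem rowSpan_le {k : ℕ} {H : Matrix (Fin k) (Fin n) F} {W : Submodule F (Fin n → F)} :
    rowSpan H ≤ W ↔ ∀ i, H i ∈ W := by
  rw [rowSpan, Submodule.span_le, Set.range_subset_iff]
  rfl

theorem row_mem_rowSpan {k : ℕ} (H : Matrix (Fin k) (Fin n) F) (i : Fin k) : H i ∈ rowSpan H :=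
  rowSpan_le.1 le_rfl i

theorem le_dual_comm {C D : Submodule F (Fin n → F)} : C ≤ dual D ↔ D ≤ dual C :=
  ⟨fun h d hd c hc => by rw [dotProduct_comm]; exact h hc d hd,
    fun h c hc d hd => by rw [dotProduct_comm]; exact h hd c hc⟩

theorem dual_anti {C D : Submodule F (Fin n → F)} (h : C ≤ D) : dual D ≤ dual C :=
  fun _ hv c hc => hv c (h hc)

theorem mem_kerCode {k : ℕ} {H : Matrix (Fin k) (Fin n) F} {v : Fin n → F} :
    v ∈ kerCode H ↔ ∀ i, H i ⬝ᵥ v = 0 := by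
  rw [kerCode, LinearMap.mem_ker, Matrix.mulVecLin_apply, funext_iff]
  rfl

theorem kerCode_eq_dual {k : ℕ} (H : Matrix (Fin k) (Fin n) F) :
    kerCode H = dual (rowSpan H) := by
  refine le_antisymm (le_dual_comm.1 <| rowSpan_le.2 fun i v hv => mem_kerCode.1 hv i) fun v hv => ?_
  refine mem_kerCode.2 fun i => ?_
  rw [dotProduct_comm]
  exact hv _ (row_mem_rowSpan H i)

theorem initX_dotProduct_initZ (r : ℕ) (i j : Fin (n / r)) :
    initX F n r i ⬝ᵥ initZ F n r j = 0 := by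
  have hr : 0 < r := by
    rcases Nat.eq_zero_or_pos r with rfl | h
    · exact absurd i.2 (by simp)
    · exact h
  simp only [dotProduct, initX, initZ, Matrix.of_apply]
  by_cases hij : i = j
  · subst hij
    have hin : r * (i : ℕ) + r ≤ n := by
      have := Nat.mul_le_mul_left r (Nat.succ_le_of_lt i.2)
      have := Nat.mul_div_le n r
      rw [Nat.succ_eq_add_one, mul_add, mul_one] at *
      omega
    -- Writing `-(r - 1) = 1 - r`, the product of the rows is the indicator of the block minus `r`
    -- at its first position, so the sum is `r - r`.
    have hterm : ∀ x : Fin n,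
        ((if r * (i : ℕ) ≤ (x : ℕ) ∧ (x : ℕ) < r * (i : ℕ) + r then 1 else 0) *
          (if (x : ℕ) = r * (i : ℕ) then -((r : F) - 1)
            else if r * (i : ℕ) < (x : ℕ) ∧ (x : ℕ) < r * (i : ℕ) + r then 1 else 0) : F) =
        (fun y : ℕ => (if y = r * (i : ℕ) then -(r : F) else 0) +
          if y ∈ Finset.Ico (r * (i : ℕ)) (r * (i : ℕ) + r) then 1 else 0) x := by
      intro x
      simp only [Finset.mem_Ico]
      split_ifs <;> first | omega | ring
    rw [Finset.sum_congr rfl fun x _ => hterm x,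
      Fin.sum_univ_eq_sum_range (fun y : ℕ => (if y = r * (i : ℕ) then -(r : F) else 0) +
        if y ∈ Finset.Ico (r * (i : ℕ)) (r * (i : ℕ) + r) then 1 else 0), Finset.sum_add_distrib,
      Finset.sum_ite_eq', if_pos (by simp; omega), Finset.sum_ite_mem,
      Finset.inter_eq_right.2 (by intro y; simp; omega)]
    simp
  · refine Finset.sum_eq_zero fun x _ => ?_
    by_cases hx : r * (i : ℕ) ≤ (x : ℕ) ∧ (x : ℕ) < r * (i : ℕ) + r
    · have hne : (i : ℕ) ≠ j := fun h => hij (Fin.ext h)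
      have hxj : ¬ (r * (j : ℕ) ≤ (x : ℕ) ∧ (x : ℕ) < r * (j : ℕ) + r) := by
        rintro ⟨h1, h2⟩
        rcases lt_or_gt_of_ne hne with h | h
        · have := Nat.mul_le_mul_left r (Nat.succ_le_of_lt h)
          rw [Nat.succ_eq_add_one, mul_add, mul_one] at this
          omega
        · have := Nat.mul_le_mul_left r (Nat.succ_le_of_lt h)
          rw [Nat.succ_eq_add_one, mul_add, mul_one] at this
          omega
      rw [if_neg (c := (x : ℕ) = _) (by omega), if_neg (c := _ < _ ∧ _) (by omega), mul_zero]
    · rw [if_neg hx, zero_mul]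

theorem rowSpan_initX_le (r : ℕ) : rowSpan (initX F n r) ≤ dual (rowSpan (initZ F n r)) := by
  rw [← kerCode_eq_dual, rowSpan_le]
  refine fun i => mem_kerCode.2 fun j => ?_
  rw [dotProduct_comm, initX_dotProduct_initZ]

end

theorem hammingNorm_le_card_of_resOff_eq_zero {n : ℕ} {F : Type*} [Field F]
    {S : Finset (Fin n)} {e : Fin n → F}
    (h : resOff F S e = 0) : hammingNorm e ≤ S.card := by
  refine Finset.card_le_card fun i hi => ?_
  by_contra hiS
  exact (Finset.mem_filter.1 hi).2 (congrFun h ⟨i, hiS⟩)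

theorem le_distance {n : ℕ} {F : Type*} [Fintype F] {C : Submodule ℂ ((Fin n → F) → ℂ)}
    {x : ℝ}
    (h : ∀ S : Finset (Fin n), (S.card : ℝ) < x → CanDecodeErasures C S) :
    ENNReal.ofReal x ≤ ((distance C : ℕ∞) : ℝ≥0∞) := by
  -- The ceiling loses nothing: a natural number is below `⌈x⌉₊` exactly when it is below `x`.
  have hd : ((⌈x⌉₊ : ℕ) : ℕ∞) ≤ distance C :=
    le_iSup₂_of_le ⌈x⌉₊ (fun S hS => h S (Nat.lt_ceil.1 hS)) le_rfl
  calc ENNReal.ofReal x ≤ (⌈x⌉₊ : ℝ≥0∞) := by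
        rw [← ENNReal.ofReal_natCast]
        exact ENNReal.ofReal_le_ofReal (Nat.le_ceil x)
    _ = (((⌈x⌉₊ : ℕ) : ℕ∞) : ℝ≥0∞) := by simp
    _ ≤ _ := ENat.toENNReal_le.2 hd

theorem forall_snoc_row {m n : ℕ} {F : Type*} (H : Matrix (Fin m) (Fin n) F)
    (v : Fin n → F) (P : (Fin n → F) → Prop) :
    (∀ i, P ((Matrix.of (Fin.snoc (α := fun _ => Fin n → F) (fun i => H i) v) :
      Matrix (Fin (m + 1)) (Fin n) F) i)) ↔ (∀ i, P (H i)) ∧ P v := by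
  have h : ∀ f : Fin (m + 1) → Fin n → F, f = Fin.snoc (α := fun _ => Fin n → F) (fun i => H i) v →
      ((∀ i, P (f i)) ↔ (∀ i, P (H i)) ∧ P v) := by
    rintro _ rfl
    rw [Fin.forall_fin_succ']
    simp only [Fin.snoc_castSucc, Fin.snoc_last]
  exact h _ rfl

/-! ### Detection probabilities and the union bound -/

section
variable {n : ℕ} {F : Type*} [Field F] [Fintype F]

theorem mem_of_mem_support_uniformDiff {W V : Submodule F (Fin n → F)} {v : Fin n → F}
    (hv : v ∈ (uniformDiff W V).support) : v ∈ W := by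
  rw [uniformDiff] at hv
  split_ifs at hv with h
  · rw [PMF.mem_support_uniformOfFinset_iff, Finset.mem_filter] at hv
    exact hv.2.1
  · rw [PMF.mem_support_pure_iff] at hv
    exact hv ▸ W.zero_mem

theorem rowSpan_of_mem_support_addRows {m : ℕ} {W : Submodule F (Fin n → F)}
    {H : Matrix (Fin m) (Fin n) F} (hH : rowSpan H ≤ W) (t : ℕ) {H' : Matrix (Fin (m + t)) (Fin n) F}
    (hH' : H' ∈ (addRows W H t).support) : rowSpan H ≤ rowSpan H' ∧ rowSpan H' ≤ W := by
  induction t with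
  | zero =>
    rw [addRows, PMF.mem_support_pure_iff] at hH'
    subst hH'
    exact ⟨le_rfl, hH⟩
  | succ t ih =>
    rw [addRows, PMF.mem_support_bind_iff] at hH'
    obtain ⟨G, hG, hH'⟩ := hH'
    rw [PMF.mem_support_map_iff] at hH'
    obtain ⟨v, hv, rfl⟩ := hH'
    obtain ⟨h1, h2⟩ := ih hG
    have h3 := fun P => forall_snoc_row G v P
    refine ⟨h1.trans (rowSpan_le.2 ((h3 (· ∈ _)).1 ?_).1),
      rowSpan_le.2 ((h3 (· ∈ W)).2 ⟨rowSpan_le.1 h2, mem_of_mem_support_uniformDiff hv⟩)⟩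
    exact rowSpan_le.1 le_rfl

/-- A random vector of `W ∖ V` is orthogonal to `e` with probability at most `1 / q`, if `e` is
orthogonal to `V` but not to `W`. -/
theorem uniformDiff_orthogonal_le {W V : Submodule F (Fin n → F)} {e : Fin n → F}
    (hV : ∀ v ∈ V, v ⬝ᵥ e = 0) (hW : ∃ w ∈ W, w ⬝ᵥ e ≠ 0) :
    (uniformDiff W V).toOuterMeasure {v | v ⬝ᵥ e = 0} ≤ (Fintype.card F : ℝ≥0∞)⁻¹ := by
  obtain ⟨w, hwW, hw⟩ := hW
  -- The detecting vector `w` itself lies in `W ∖ V`, so the default distribution `PMF.pure 0` does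
  -- not occur here.
  have hne : (Finset.univ.filter fun v => v ∈ W ∧ v ∉ V).Nonempty :=
    ⟨w, by simpa using ⟨hwW, fun h => hw (hV w h)⟩⟩
  rw [uniformDiff, dif_pos hne, PMF.toOuterMeasure_uniformOfFinset_apply]
  have hcard : Fintype.card F *
      ((Finset.univ.filter fun v => v ∈ W ∧ v ∉ V).filter (· ∈ {v | v ⬝ᵥ e = 0})).card ≤
      (Finset.univ.filter fun v => v ∈ W ∧ v ∉ V).card := by
    rw [← Finset.card_univ, ← Finset.card_product]
    have hdot : ∀ (a : F) (v : Fin n → F), v ⬝ᵥ e = 0 → (v + a • w) ⬝ᵥ e = a * (w ⬝ᵥ e) :=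
      fun a v hv => by rw [add_dotProduct, hv, zero_add, smul_dotProduct, smul_eq_mul]
    -- The product of the image with `e` is `a * (w ⬝ᵥ e)`, which recovers `a`. If the image were in
    -- `V`, this would force `a = 0` and so `v ∈ V`.
    refine Finset.card_le_card_of_injOn (fun p => p.2 + p.1 • w) ?_ ?_
    · rintro ⟨a, v⟩ hp
      simp only [Finset.coe_product, Set.mem_prod, Finset.mem_coe, Finset.mem_filter,
        Finset.mem_univ, true_and, Set.mem_ofPred_eq] at hp ⊢
      obtain ⟨⟨hvW, hvV⟩, hve⟩ := hp
      refine ⟨W.add_mem hvW (W.smul_mem a hwW), fun h => hvV ?_⟩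
      have h0 := hV _ h
      rw [hdot a v hve] at h0
      have ha := (mul_eq_zero.1 h0).resolve_right hw
      simpa [ha] using h
    · rintro ⟨a, v⟩ hp ⟨b, u⟩ hp' hab
      simp only [Finset.coe_product, Set.mem_prod, Finset.mem_coe, Finset.mem_filter,
        Finset.mem_univ, true_and, Set.mem_ofPred_eq] at hp hp' hab
      have h := congrArg (· ⬝ᵥ e) hab
      simp only [hdot _ _ hp.2, hdot _ _ hp'.2] at h
      have hab' := mul_right_cancel₀ hw h
      subst hab'
      simpa using hab
  refine ENNReal.div_le_of_le_mul ?_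
  rw [← ENNReal.div_eq_inv_mul, ENNReal.le_div_iff_mul_le (by simp) (by simp), mul_comm]
  exact_mod_cast hcard

/-- If `e` is not orthogonal to `W`, then `t` added random rows are all orthogonal to `e` with
probability at most `q ^ (-t)`. -/
theorem addRows_orthogonal_le {m : ℕ} {W : Submodule F (Fin n → F)} (H : Matrix (Fin m) (Fin n) F)
    {e : Fin n → F} (hW : ∃ w ∈ W, w ⬝ᵥ e ≠ 0) (t : ℕ) :
    (addRows W H t).toOuterMeasure {H' | e ∈ kerCode H'} ≤ (Fintype.card F : ℝ≥0∞)⁻¹ ^ t := by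
  induction t with
  | zero =>
    rw [addRows, PMF.toOuterMeasure_pure_apply, pow_zero]
    split_ifs <;> simp
  | succ t ih =>
    rw [addRows, PMF.toOuterMeasure_bind_apply, pow_succ]
    refine le_trans ?_ (mul_le_mul_left ih _)
    rw [PMF.toOuterMeasure_apply, ← ENNReal.tsum_mul_right]
    refine ENNReal.tsum_le_tsum fun G => ?_
    rw [PMF.toOuterMeasure_map_apply]
    have hpre : (fun v => (Matrix.of (Fin.snoc (α := fun _ => Fin n → F) (fun i => G i) v) :
        Matrix (Fin (m + t + 1)) (Fin n) F)) ⁻¹' {H' | e ∈ kerCode H'} =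
        {v | e ∈ kerCode G ∧ v ⬝ᵥ e = 0} := by
      ext v
      simp only [Set.mem_preimage, Set.mem_ofPred_eq, mem_kerCode]
      exact forall_snoc_row G v (· ⬝ᵥ e = 0)
    have hle : (uniformDiff W (rowSpan G)).toOuterMeasure {v | e ∈ kerCode G ∧ v ⬝ᵥ e = 0} ≤
        -- If `e` already fails a row of `G` the event is empty; otherwise `e` is orthogonal to
        -- `rowSpan G`, as the one-step bound requires.
        {H' | e ∈ kerCode H'}.indicator (fun _ => (Fintype.card F : ℝ≥0∞)⁻¹) G := by
      by_cases hG : e ∈ kerCode G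
      · rw [Set.indicator_of_mem (s := {H' | e ∈ kerCode H'}) hG]
        simp only [hG, true_and]
        refine uniformDiff_orthogonal_le (fun v hv => ?_) hW
        rw [kerCode_eq_dual] at hG
        rw [dotProduct_comm]
        exact hG v hv
      · simp [hG]
    refine le_trans (mul_le_mul_right (le_trans (le_of_eq ?_) hle) _) (le_of_eq ?_)
    · exact congrArg _ hpre
    · by_cases hG : e ∈ kerCode G <;> simp [Set.indicator, hG]

theorem toOuterMeasure_bind_le {α β : Type*} (p : PMF α) (f : α → PMF β) (s : Set β) (c : ℝ≥0∞)
    (h : ∀ a, (f a).toOuterMeasure s ≤ c) : (p.bind f).toOuterMeasure s ≤ c := by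
  rw [PMF.toOuterMeasure_bind_apply]
  calc ∑' a, p a * (f a).toOuterMeasure s ≤ ∑' a, p a * c :=
        ENNReal.tsum_le_tsum fun a => mul_le_mul_right (h a) _
    _ = c := by rw [ENNReal.tsum_mul_right, p.tsum_coe, one_mul]

theorem toOuterMeasure_bind_map_pair {α β : Type*} (p : PMF α) (f : α → PMF β) (s : Set α) :
    (p.bind fun a => (f a).map fun b => (a, b)).toOuterMeasure {x | x.1 ∈ s} =
      p.toOuterMeasure s := by
  rw [PMF.toOuterMeasure_bind_apply, PMF.toOuterMeasure_apply]
  refine tsum_congr fun a => ?_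
  rw [PMF.toOuterMeasure_map_apply]
  by_cases ha : a ∈ s
  · have : (fun b => (a, b)) ⁻¹' {x : α × β | x.1 ∈ s} = Set.univ := by ext; simp [ha]
    rw [this, (PMF.toOuterMeasure_apply_eq_one_iff _ _).2 (Set.subset_univ _)]
    simp [ha]
  · have : (fun b => (a, b)) ⁻¹' {x : α × β | x.1 ∈ s} = ∅ := by ext; simp [ha]
    rw [this]
    simp [ha]

theorem exists_dotProduct_ne_zero {C : Submodule F (Fin n → F)} {e : Fin n → F} (h : e ∉ dual C) :
    ∃ w ∈ C, w ⬝ᵥ e ≠ 0 := by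
  by_contra! h'
  exact h fun c hc => by rw [dotProduct_comm]; exact h' c hc

/-- A vector which some word orthogonal to the initial `Z` checks detects passes all `X` checks with
probability at most `q ^ (-ℓ)`. -/
theorem sampleChecks_fst_le (r ℓ : ℕ) (e : Fin n → F) :
    (sampleChecks F n r ℓ).toOuterMeasure
      {p | e ∈ kerCode p.1 ∧ e ∉ dual (kerCode (initZ F n r))} ≤
      (Fintype.card F : ℝ≥0∞)⁻¹ ^ ℓ := by
  by_cases he : e ∈ dual (kerCode (initZ F n r))
  · simp [he]
  · have := toOuterMeasure_bind_map_pair (addRows (dual (rowSpan (initZ F n r))) (initX F n r) ℓ)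
      (fun HX => addRows (dual (rowSpan HX)) (initZ F n r) ℓ) {H | e ∈ kerCode H}
    simp only [he, not_false_eq_true, and_true]
    refine le_trans (le_of_eq this) (addRows_orthogonal_le _ ?_ ℓ)
    rw [kerCode_eq_dual] at he
    exact exists_dotProduct_ne_zero he

/-- A fixed vector passes all `Z` checks and is not spanned by the `X` checks with probability at most
`q ^ (-ℓ)`. -/
theorem sampleChecks_snd_le (r ℓ : ℕ) (e : Fin n → F) :
    (sampleChecks F n r ℓ).toOuterMeasure
      {p | e ∈ kerCode p.2 ∧ e ∉ dual (kerCode p.1)} ≤ (Fintype.card F : ℝ≥0∞)⁻¹ ^ ℓ := by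
  refine toOuterMeasure_bind_le _ _ _ _ fun HX => ?_
  rw [PMF.toOuterMeasure_map_apply]
  by_cases he : e ∈ dual (kerCode HX)
  · simp [he]
  · refine le_trans (PMF.toOuterMeasure_mono _ ?_)
      (addRows_orthogonal_le (initZ F n r)
        (exists_dotProduct_ne_zero (kerCode_eq_dual HX ▸ he)) ℓ)
    exact fun H hH => hH.1.1

/-- The nonzero words of weight less than `x`. -/
noncomputable def lightWords (F : Type*) [Field F] [Fintype F] (n : ℕ) (x : ℝ) :
    Finset (Fin n → F) :=
  Finset.univ.filter fun e => e ≠ 0 ∧ (hammingNorm e : ℝ) < x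

/-- Sampled checks failed by every nontrivial light word give a code of large distance. -/
theorem le_distance_of_mem_support {r ℓ : ℕ} {x : ℝ}
    {p : Matrix (Fin (n / r + ℓ)) (Fin n) F × Matrix (Fin (n / r + ℓ)) (Fin n) F}
    (hp : p ∈ (sampleChecks F n r ℓ).support)
    (h1 : ∀ e ∈ lightWords F n x, e ∈ kerCode p.1 → e ∈ dual (kerCode (initZ F n r)))
    (h2 : ∀ e ∈ lightWords F n x, e ∈ kerCode p.2 → e ∈ dual (kerCode p.1)) :
    ENNReal.ofReal x ≤ ((distance (css (kerCode p.1) (kerCode p.2)) : ℕ∞) : ℝ≥0∞) := by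
  rw [sampleChecks, PMF.mem_support_bind_iff] at hp
  obtain ⟨HX, hHX, hp⟩ := hp
  rw [PMF.mem_support_map_iff] at hp
  obtain ⟨HZ, hHZ, rfl⟩ := hp
  have hX := rowSpan_of_mem_support_addRows (rowSpan_initX_le r) ℓ hHX
  have hZ := rowSpan_of_mem_support_addRows (le_dual_comm.1 hX.2) ℓ hHZ
  have hle : dual (kerCode HX) ≤ kerCode HZ := by
    rw [kerCode_eq_dual HZ, kerCode_eq_dual HX]
    exact dual_anti hZ.2
  have hlight : ∀ (S : Finset (Fin n)) (e : Fin n → F), (S.card : ℝ) < x → resOff F S e = 0 →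
      e ≠ 0 → e ∈ lightWords F n x := fun S e hS he h0 => by
    refine Finset.mem_filter.2 ⟨Finset.mem_univ _, h0, lt_of_le_of_lt ?_ hS⟩
    exact_mod_cast hammingNorm_le_card_of_resOff_eq_zero he
  refine le_distance fun S hS => css_canDecodeErasures hle (fun e he hSe => ?_) fun e he hSe => ?_
  · by_cases h0 : e = 0
    · exact h0 ▸ Submodule.zero_mem _
    · exact h2 e (hlight S e hS hSe h0) he
  · by_cases h0 : e = 0
    · exact h0 ▸ Submodule.zero_mem _
    -- Being spanned by the initial `Z` checks suffices, since they remain rows of the completed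
    -- matrix.
    · refine dual_anti ?_ (h1 e (hlight S e hS hSe h0) he)
      rw [kerCode_eq_dual HZ, kerCode_eq_dual (initZ F n r)]
      exact dual_anti hZ.1

theorem probDistanceGE_ge (r ℓ : ℕ) (x : ℝ) :
    1 - 2 * ((lightWords F n x).card * ((Fintype.card F : ℝ)⁻¹ ^ ℓ)) ≤
      probDistanceGE F n r ℓ x := by
  set μ := (sampleChecks F n r ℓ).toOuterMeasure with hμ
  set c : ℝ≥0∞ := (Fintype.card F : ℝ≥0∞)⁻¹ ^ ℓ with hc
  set E := lightWords F n x
  have hgood : probDistanceGE F n r ℓ x =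
      (μ {p | ENNReal.ofReal x ≤
        ((distance (css (kerCode p.1) (kerCode p.2)) : ℕ∞) : ℝ≥0∞)}).toReal := by
    rw [probDistanceGE, randomQLRC, PMF.toOuterMeasure_map_apply]
    rfl
  set G := {p : Matrix (Fin (n / r + ℓ)) (Fin n) F × Matrix (Fin (n / r + ℓ)) (Fin n) F |
    ENNReal.ofReal x ≤ ((distance (css (kerCode p.1) (kerCode p.2)) : ℕ∞) : ℝ≥0∞)}
  set B1 := fun e : Fin n → F =>
    {p : Matrix (Fin (n / r + ℓ)) (Fin n) F × Matrix (Fin (n / r + ℓ)) (Fin n) F |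
      e ∈ kerCode p.1 ∧ e ∉ dual (kerCode (initZ F n r))}
  set B2 := fun e : Fin n → F =>
    {p : Matrix (Fin (n / r + ℓ)) (Fin n) F × Matrix (Fin (n / r + ℓ)) (Fin n) F |
      e ∈ kerCode p.2 ∧ e ∉ dual (kerCode p.1)}
  have hcover : μ Set.univ ≤ μ (G ∪ ((⋃ e ∈ E, B1 e) ∪ ⋃ e ∈ E, B2 e)) := by
    refine PMF.toOuterMeasure_mono _ ?_
    rintro p ⟨-, hp⟩
    by_contra hcon
    simp only [Set.mem_union, Set.mem_iUnion, not_or, not_exists] at hcon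
    obtain ⟨hG, h1, h2⟩ := hcon
    refine hG (le_distance_of_mem_support hp (fun e he hek => ?_) fun e he hek => ?_)
    · by_contra hn
      exact h1 e he ⟨hek, hn⟩
    · by_contra hn
      exact h2 e he ⟨hek, hn⟩
  have hsum : ∀ B : (Fin n → F) → Set _, (∀ e, μ (B e) ≤ c) →
      μ (⋃ e ∈ E, B e) ≤ E.card * c := fun B hB =>
    calc μ (⋃ e ∈ E, B e) ≤ ∑ e ∈ E, μ (B e) := MeasureTheory.measure_biUnion_finset_le _ _
      _ ≤ ∑ _e ∈ E, c := Finset.sum_le_sum fun e _ => hB e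
      _ = E.card * c := by simp
  have huniv : μ Set.univ = 1 := (PMF.toOuterMeasure_apply_eq_one_iff _ _).2 (Set.subset_univ _)
  have hle : 1 ≤ μ G + (E.card * c + E.card * c) := by
    rw [← huniv]
    refine hcover.trans ((MeasureTheory.measure_union_le _ _).trans (add_le_add le_rfl ?_))
    refine (MeasureTheory.measure_union_le _ _).trans (add_le_add ?_ ?_)
    · exact hsum B1 fun e => sampleChecks_fst_le r ℓ e
    · exact hsum B2 fun e => sampleChecks_snd_le r ℓ e
  have hGfin : μ G ≠ ⊤ :=
    ne_top_of_le_ne_top ENNReal.one_ne_top (huniv ▸ MeasureTheory.measure_mono (Set.subset_univ G))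
  have hcfin : c ≠ ⊤ := ENNReal.pow_ne_top (by simp)
  have hEfin : (E.card * c : ℝ≥0∞) ≠ ⊤ := ENNReal.mul_ne_top (by simp) hcfin
  have hreal := ENNReal.toReal_mono
    (ENNReal.add_ne_top.2 ⟨hGfin, ENNReal.add_ne_top.2 ⟨hEfin, hEfin⟩⟩) hle
  rw [ENNReal.toReal_add hGfin (ENNReal.add_ne_top.2 ⟨hEfin, hEfin⟩),
    ENNReal.toReal_add hEfin hEfin, ENNReal.toReal_mul, hc, ENNReal.toReal_pow,
    ENNReal.toReal_inv] at hreal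
  simp only [ENNReal.toReal_one, ENNReal.toReal_natCast] at hreal
  rw [hgood]
  linarith

end

/-! ### Counting words of low weight -/

section
variable {n : ℕ} {F : Type*} [Field F] [Fintype F]

/-- The weights are those of independent letters, zero with weight `1 - δ` and otherwise uniform
over the nonzero letters. -/
theorem sum_weight_eq_one (hF : 1 < Fintype.card F) (δ : ℝ) :
    ∑ e : Fin n → F, ∏ i, (if e i = 0 then 1 - δ else δ / ((Fintype.card F : ℝ) - 1)) = 1 := by
  have hq : (Fintype.card F : ℝ) - 1 ≠ 0 := by
    have : (1 : ℝ) < Fintype.card F := by exact_mod_cast hF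
    linarith
  have h1 : ∑ a : F, (if a = 0 then 1 - δ else δ / ((Fintype.card F : ℝ) - 1)) = 1 := by
    rw [← Finset.add_sum_erase _ _ (Finset.mem_univ 0), if_pos rfl,
      Finset.sum_congr rfl fun a ha => if_neg (Finset.ne_of_mem_erase ha), Finset.sum_const,
      Finset.card_erase_of_mem (Finset.mem_univ _), Finset.card_univ, nsmul_eq_mul,
      Nat.cast_sub hF.le]
    push_cast
    field_simp
    ring
  have h2 := Finset.prod_univ_sum (fun _ : Fin n => (Finset.univ : Finset F))
    fun _ a => if a = 0 then 1 - δ else δ / ((Fintype.card F : ℝ) - 1)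
  rw [Fintype.piFinset_univ] at h2
  rw [← h2, h1, Finset.prod_const_one]

/-- The bound `δ ≤ 1 - 1 / q` amounts to `δ / (q - 1) ≤ 1 - δ`, so the product does not increase
with the Hamming weight. Formally evaluated at weight `δ n` it equals the left side. -/
theorem rpow_neg_entropy_le_weight {δ : ℝ} (hF : 1 < Fintype.card F) (hδ : 0 < δ)
    (hδ' : δ ≤ 1 - 1 / (Fintype.card F : ℝ)) {e : Fin n → F} (he : (hammingNorm e : ℝ) ≤ δ * n) :
    (Fintype.card F : ℝ) ^ (-(qEntropy (Fintype.card F) δ * n)) ≤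
      ∏ i, (if e i = 0 then 1 - δ else δ / ((Fintype.card F : ℝ) - 1)) := by
  set q : ℝ := (Fintype.card F : ℝ)
  have hq : 1 < q := Nat.one_lt_cast.2 hF
  have hq0 : 0 < q := by linarith
  have hlog : Real.log q ≠ 0 := (Real.log_pos hq).ne'
  have hb : 0 < 1 - δ := by
    have : 0 < 1 / q := by positivity
    linarith
  have ha : 0 < δ / (q - 1) := div_pos hδ (by linarith)
  have hab : δ / (q - 1) ≤ 1 - δ := by
    rw [div_le_iff₀ (by linarith)]
    have : δ * q ≤ q - 1 := by
      calc δ * q ≤ (1 - 1 / q) * q := by gcongr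
        _ = q - 1 := by field_simp
    linarith
  have hlab := Real.log_le_log ha hab
  have hpos : ∀ i, 0 < (if e i = 0 then 1 - δ else δ / (q - 1)) := fun i => by
    split_ifs <;> assumption
  have hw : ∑ i, Real.log (if e i = 0 then 1 - δ else δ / (q - 1)) =
      n * Real.log (1 - δ) - hammingNorm e * (Real.log (1 - δ) - Real.log (δ / (q - 1))) := by
    have : ∀ i, Real.log (if e i = 0 then 1 - δ else δ / (q - 1)) =
        Real.log (1 - δ) -
          if e i ≠ 0 then (Real.log (1 - δ) - Real.log (δ / (q - 1))) else 0 := fun i => by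
      split_ifs <;> simp_all
    rw [Finset.sum_congr rfl fun i _ => this i, Finset.sum_sub_distrib, ← Finset.sum_filter]
    simp only [Finset.sum_const, Finset.card_univ, Fintype.card_fin, nsmul_eq_mul, hammingNorm]
  have hprod : ∏ i, (if e i = 0 then 1 - δ else δ / (q - 1)) =
      Real.exp (∑ i, Real.log (if e i = 0 then 1 - δ else δ / (q - 1))) := by
    rw [Real.exp_sum]
    exact Finset.prod_congr rfl fun i _ => (Real.exp_log (hpos i)).symm
  rw [hprod, hw, Real.rpow_def_of_pos hq0, Real.exp_le_exp]
  have hent : Real.log q * qEntropy q δ =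
      δ * Real.log (q - 1) - δ * Real.log δ - (1 - δ) * Real.log (1 - δ) := by
    simp only [qEntropy, Real.logb]
    field_simp
  have hla : Real.log (δ / (q - 1)) = Real.log δ - Real.log (q - 1) :=
    Real.log_div hδ.ne' (by linarith)
  have hmul := mul_le_mul_of_nonneg_right he (sub_nonneg.2 hlab)
  calc Real.log q * -(qEntropy q δ * n) = -(Real.log q * qEntropy q δ) * n := by ring
    _ = n * Real.log (1 - δ) - δ * n * (Real.log (1 - δ) - Real.log (δ / (q - 1))) := by
      rw [hent, hla]; ring
    _ ≤ _ := by linarith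

theorem card_lightWords_lt {δ : ℝ} (hF : 1 < Fintype.card F) (hδ : 0 < δ)
    (hδ' : δ ≤ 1 - 1 / (Fintype.card F : ℝ)) :
    ((lightWords F n (δ * n)).card : ℝ) <
      (Fintype.card F : ℝ) ^ (qEntropy (Fintype.card F) δ * n) := by
  set q : ℝ := (Fintype.card F : ℝ)
  have hq : 0 < q := Nat.cast_pos.2 (zero_lt_one.trans hF)
  have h0 : (0 : Fin n → F) ∉ lightWords F n (δ * n) := by simp [lightWords]
  have hb : 0 ≤ 1 - δ := by
    have : 0 < 1 / q := by positivity
    linarith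
  have hq1 : 0 ≤ q - 1 := by
    have : 1 < q := Nat.one_lt_cast.2 hF
    linarith
  -- Counting the zero word as well makes the final inequality strict.
  have hle : ((insert 0 (lightWords F n (δ * n))).card : ℝ) * q ^ (-(qEntropy q δ * n)) ≤ 1 := by
    rw [← nsmul_eq_mul, ← Finset.sum_const, ← sum_weight_eq_one (n := n) hF δ]
    refine (Finset.sum_le_sum fun e he => rpow_neg_entropy_le_weight hF hδ hδ' ?_).trans
      (Finset.sum_le_sum_of_subset_of_nonneg (Finset.subset_univ _) fun e _ _ =>
        Finset.prod_nonneg fun i _ => ?_)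
    · rcases Finset.mem_insert.1 he with rfl | he
      · simp only [hammingNorm_zero, Nat.cast_zero]
        positivity
      · exact (Finset.mem_filter.1 he).2.2.le
    · split_ifs
      · exact hb
      · exact div_nonneg hδ.le hq1
  rw [Finset.card_insert_of_notMem h0, Real.rpow_neg hq.le, ← div_eq_mul_inv,
    div_le_one (by positivity)] at hle
  push_cast at hle
  linarith

theorem probDistanceGE_gt {r ℓ : ℕ} {δ ε : ℝ} (hδ : 0 < δ)
    (hδ' : δ ≤ 1 - 1 / (Fintype.card F : ℝ))
    (hℓ : (qEntropy (Fintype.card F) δ + ε) * n ≤ ℓ) :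
    1 - 2 * (Fintype.card F : ℝ) ^ (-(ε * n)) < probDistanceGE F n r ℓ (δ * n) := by
  have hF : 1 < Fintype.card F := Fintype.one_lt_card
  have hq : (1 : ℝ) < Fintype.card F := by exact_mod_cast hF
  refine lt_of_lt_of_le ?_ (probDistanceGE_ge r ℓ (δ * n))
  have hpow : (0 : ℝ) < (Fintype.card F : ℝ)⁻¹ ^ ℓ := by positivity
  have hlt := mul_lt_mul_of_pos_right (card_lightWords_lt (n := n) hF hδ hδ') hpow
  have hle : (Fintype.card F : ℝ) ^ (qEntropy (Fintype.card F) δ * n) *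
      (Fintype.card F : ℝ)⁻¹ ^ ℓ ≤ (Fintype.card F : ℝ) ^ (-(ε * n)) := by
    rw [inv_pow, ← Real.rpow_natCast, ← Real.rpow_neg (by positivity),
      ← Real.rpow_add (by positivity)]
    exact Real.rpow_le_rpow_of_exponent_le hq.le (by linarith)
  linarith

end

/-- Multiplied by `log q`, the entropy is `δ log (q - 1)` plus the binary entropy of `δ`, which is
at most `log 2`. -/
theorem qEntropy_le {q δ : ℝ} (hq : 1 < q) (hδ : 0 < δ) (hδ' : δ < 1) :
    qEntropy q δ ≤ δ + Real.log 2 / Real.log q := by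
  have hlog : 0 < Real.log q := Real.log_pos hq
  have h1 : Real.log (q - 1) ≤ Real.log q := Real.log_le_log (by linarith) (by linarith)
  have h2 : -δ * Real.log δ - (1 - δ) * Real.log (1 - δ) ≤ Real.log 2 := by
    have := Real.binEntropy_le_log_two (p := δ)
    rw [Real.binEntropy, Real.log_inv, Real.log_inv] at this
    linarith
  rw [show qEntropy q δ = (δ * Real.log (q - 1) +
    (-δ * Real.log δ - (1 - δ) * Real.log (1 - δ))) / Real.log q by
      simp only [qEntropy, Real.logb]; ring,
    div_le_iff₀ hlog, add_mul, div_mul_cancel₀ _ hlog.ne']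
  nlinarith

end RandomQLRC

theorem proposition4p2 (F : Type*) [Field F] [Fintype F] (q : ℕ) (hq : Fintype.card F = q)
    (n r ℓ : ℕ) (hr : r ∣ n) (hℓ : (ℓ : ℝ) < (n : ℝ) / 2 - (n : ℝ) / r)
    (δ ε : ℝ) (hδ : 0 < δ) (hε : 0 < ε) :
    (δ ≤ 1 - 1 / (q : ℝ) → (RandomQLRC.qEntropy q δ + ε) * n ≤ ℓ →
      RandomQLRC.probDistanceGE F n r ℓ (δ * n) > 1 - 2 * (q : ℝ) ^ (-(ε * n))) ∧
    ((2 : ℝ) ^ (2 / ε) ≤ q → (δ + ε) * n ≤ ℓ →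
      RandomQLRC.probDistanceGE F n r ℓ (δ * n) > 1 - 2 * (q : ℝ) ^ (-(ε * n / 2))) := by
  subst hq
  refine ⟨fun h1 h2 => RandomQLRC.probDistanceGE_gt hδ h1 h2, fun h1 h2 => ?_⟩
  have hq2 : (2 : ℝ) ≤ Fintype.card F := by exact_mod_cast (Fintype.one_lt_card : 1 < Fintype.card F)
  -- For `n = 0` the upper bound on `ℓ` would read `ℓ < 0`.
  have hn : (0 : ℝ) < n := by
    rcases Nat.eq_zero_or_pos n with rfl | h
    · have : (0 : ℝ) ≤ ℓ := Nat.cast_nonneg _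
      simp at hℓ
      linarith
    · exact_mod_cast h
  -- This comes from `δ n ≤ ℓ < n / 2`, and with `q ≥ 2` it yields the condition `δ ≤ 1 - 1 / q` of
  -- the first regime.
  have hδ2 : δ < 1 / 2 := by
    have hnr : (0 : ℝ) ≤ n / r := by positivity
    have h3 : δ * n < 1 / 2 * n := by nlinarith
    exact lt_of_mul_lt_mul_right h3 hn.le
  have hδ' : δ ≤ 1 - 1 / (Fintype.card F : ℝ) := by
    have : 1 / (Fintype.card F : ℝ) ≤ 1 / 2 := one_div_le_one_div_of_le (by norm_num) hq2
    linarith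
  have hlog : 0 < Real.log (Fintype.card F) := Real.log_pos (by linarith)
  have hlogε : Real.log 2 / Real.log (Fintype.card F) ≤ ε / 2 := by
    have h3 := Real.log_le_log (by positivity) h1
    rw [Real.log_rpow (by norm_num), div_mul_eq_mul_div, div_le_iff₀ hε] at h3
    rw [div_le_iff₀ hlog]
    linarith
  have hent := RandomQLRC.qEntropy_le (by linarith : (1 : ℝ) < Fintype.card F) hδ (by linarith)
  -- Half of `ε` pays for the binary entropy term; the other half remains as the slack in the first
  -- regime.
  have h4 : (RandomQLRC.qEntropy (Fintype.card F) δ + ε / 2) * n ≤ ℓ :=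
    (mul_le_mul_of_nonneg_right (by linarith) hn.le).trans h2
  have := RandomQLRC.probDistanceGE_gt (r := r) hδ hδ' h4
  rwa [div_mul_eq_mul_div] at this
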